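/- Let $k=\mathbb{F}_q$ be a finite field, let $m\ge 1$ and $n>1$ be integers, and let $A=M_n(q^m)$ be the algebra of $n\times n$ matrices over $\mathbb{F}_{q^m}$, regarded as a unital $k$-algebra. (These are, up to isomorphism, the finite simple $k$-algebras that are not fields.) For a positive integer $\alpha\le n$, let $A_\alpha$ be the set of matrices of rank $\alpha$ in $A$, and let $$P_\alpha(A)=\frac{|\{(x,y)\in A_\alpha\times A_\alpha : \langle x,y\rangle = A\}|}{|A_\alpha|^2},$$ where $\langle x,y\rangle$ denotes the unital $k$-subalgebra of $A$ generated by $x$ and $y$. (i) Let $p$ be the smallest prime divisor of $n$. If $1\le\alpha\le n/p$, then $P_\alpha(A)\le 1-q^{-2mp\alpha^2}$. (ii) If $n-\sqrt{n}/3\le\alpha\le n$, then $P_\alpha(A)\to 1$ as $|A|\to\infty$. That is, for every $\varepsilon>0$ there is an $N$ such that $|P_\alpha(A)-1|<\varepsilon$ for all prime powers $q$, all integers $m\ge1$, $n>1$ and all integers $\alpha$ with $n-\sqrt{n}/3\le\alpha\le n$ such that $|A|=q^{mn^2}\ge N$. -/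

import Mathlib

/-- The set `A_α` of all matrices of rank `α` in `A = M_n(K)`. -/
def rankSet (K : Type*) [Field K] (n α : ℕ) : Set (Matrix (Fin n) (Fin n) K) :=
  {x | x.rank = α}

/-- The set of pairs `(x, y) ∈ A_α × A_α` that generate `A = M_n(K)` as a unital `k`-algebra. -/
def rankGeneratingPairs (k K : Type*) [Field k] [Field K] [Algebra k K] (n α : ℕ) :
    Set (Matrix (Fin n) (Fin n) K × Matrix (Fin n) (Fin n) K) :=
  {z | z.1 ∈ rankSet K n α ∧ z.2 ∈ rankSet K n α ∧ Algebra.adjoin k {z.1, z.2} = ⊤}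

/-- `P_α(A)` for the `k`-algebra `A = M_n(K)`, with `k ⊆ K` finite fields: the probability that two
independent uniformly random elements of `A_α` generate `A` as a `k`-algebra. -/
noncomputable def rankGenProb (k K : Type*) [Field k] [Field K] [Algebra k K] (n α : ℕ) : ℝ :=
  ((rankGeneratingPairs k K n α).ncard : ℝ) / ((rankSet K n α).ncard : ℝ) ^ 2

/-!
Write `Q = |K|`, and let `A` be the ring of `n × n` matrices over `K`, acting on `V = K ^ n`.

**Upper bound for small rank.** If `α ≤ n / p`, then either `2 α < n`, and two matrices of rank
`α` have a common kernel vector, so that they never generate; or `p = 2` and `n = 2 α`. In the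
latter case the pairs `(x, x)` do not generate, since `A` is not commutative, and they are a share
of `1 / |A_α| ≥ Q ^ (-n ^ 2)`, which is the claimed bound (`rankGenProb_le`).

**Limit for large rank.** The pairs in `A × A` lying in a proper subring are counted irrespective
of rank (`ncard_pairs_in_proper_subring_le`): they are a share of at most `12 n Q ^ (1 - n)`. For
`α = n - c` the set `A_α` has at least `Q ^ (n ^ 2 - c ^ 2) / 4` elements
(`card_matrix_le_mul_ncard_rankSet`), so the share of the non-generating pairs within `A_α × A_α`
is at most `192 n Q ^ (2 c ^ 2 - n + 1)`. As `9 c ^ 2 ≤ n`, the exponent is at most `-n / 4`, and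
this tends to `0` as `|A|` grows.

The count over all of `A × A` rests on a description of the proper subrings `B`
(`mem_intertwinedPairs_of_ne_top`). Either `B` stabilizes a proper nonzero subspace. Or it acts
irreducibly and commutes with a non-scalar, which by Schur's lemma generates a field `L ⊋ K`, so
that `B` embeds in some `M_s(L)` with `s [L : K] = n`. Or it acts irreducibly with commutant `K`;
then `B` is a simple ring, and by the theorems of Wedderburn–Artin and Wedderburn it is a
conjugate of `M_n(F)` for a subfield `F` of `K`. In each case the pair acts on a copy in `V` of
some representation `W` of a matrix ring `R = M_s(L)` through elements of `R`. The units of `R`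
act freely on the ways of exhibiting a given pair like this, and at least a quarter of `R`
consists of units; dividing by their number gives one bound for all three cases
(`ncard_intertwinedPairs_le`).
-/

/-! ### Irreducible rings of endomorphisms -/

section Structure

open Module

variable {K V : Type*} [Field K] [AddCommGroup V] [Module K V]

/-- A ring `B` of `K`-endomorphisms of `V` acts irreducibly if the only `K`-subspaces of `V` stable
under `B` are `0` and `V`. As `B` need not contain the scalars of `K`, the action of `B` alone
may be reducible. -/
def ActsIrreducibly (B : Subring (End K V)) : Prop :=
  ∀ W : Submodule K V, (∀ b ∈ B, ∀ w ∈ W, b w ∈ W) → W = ⊥ ∨ W = ⊤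

/-- The isotypic component of a simple `B`-submodule is stable under the scalars of `K`, because
they commute with `B`. Hence it is all of `V`. -/
theorem ActsIrreducibly.exists_isotypicComponent_eq_top [Finite V] [Nontrivial V]
    {B : Subring (End K V)} (hB : ActsIrreducibly B) :
    ∃ U : Submodule B V, IsSimpleModule B U ∧ isotypicComponent B V U = ⊤ := by
  obtain ⟨U, hU⟩ := IsAtomic.exists_atom (Submodule B V)
  have hs : IsSimpleModule B U := isSimpleModule_iff_isAtom.mpr hU
  refine ⟨U, hs, ?_⟩
  have hfull : (isotypicComponent B V U).IsFullyInvariant :=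
    Submodule.IsFullyInvariant.isotypicComponent B V U
  let W : Submodule K V :=
    { (isotypicComponent B V U).toAddSubmonoid with
      smul_mem' := fun c x hx => by
        let f : V →ₗ[B] V :=
          { toFun := fun v => c • v
            map_add' := fun _ _ => smul_add _ _ _
            map_smul' := fun b v => smul_comm c b v }
        exact hfull f hx }
  rcases hB W (fun b hb w hw => (isotypicComponent B V U).smul_mem (⟨b, hb⟩ : B) hw) with h | h
  · have hlt := bot_lt_isotypicComponent (R := B) (M := V) U
    exfalso
    refine hlt.ne' ((Submodule.eq_bot_iff _).mpr fun x hx => ?_)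
    have : x ∈ W := hx
    rw [h] at this
    exact this
  · rw [Submodule.eq_top_iff']
    intro x
    have : x ∈ W := h ▸ Submodule.mem_top
    exact this

/-- A ring acting irreducibly on a finite space embeds, as a left module, into a power of `V`,
which is semisimple and isotypic. So it is a simple ring. -/
theorem ActsIrreducibly.isSimpleRing [Finite V] [Nontrivial V]
    {B : Subring (End K V)} (hB : ActsIrreducibly B) :
    IsSimpleRing B ∧ IsArtinianRing B := by
  obtain ⟨U, hU, htop⟩ := hB.exists_isotypicComponent_eq_top
  have hss : IsSemisimpleModule B V := by
    have h : IsSemisimpleModule B (isotypicComponent B V U) := inferInstance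
    rw [htop] at h
    exact IsSemisimpleModule.congr (Submodule.topEquiv (R := B) (M := V)).symm
  have hiso : IsIsotypicOfType B V U := by
    have h := IsIsotypicOfType.isotypicComponent B V U
    rw [htop] at h
    exact h.of_injective (Submodule.topEquiv (R := B) (M := V)).symm.toLinearMap
      (LinearEquiv.injective _)
  rw [isSimpleRing_isArtinianRing_iff]
  let ev : V → (B →ₗ[B] V) := fun v => LinearMap.toSpanSingleton B V v
  have hev : ∀ (v : V) (b : B), ev v b = b.1 v := fun v b => rfl
  refine ⟨?_, ?_, ?_⟩
  · cases nonempty_fintype V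
    refine IsSemisimpleModule.of_injective (M := V → V) (LinearMap.pi ev) ?_
    intro a b hab
    apply Subtype.ext
    ext v
    exact congrFun hab v
  · have key : IsIsotypicOfType B B U := by
      intro S hS
      have : ∃ v : V, (ev v).comp S.subtype ≠ 0 := by
        by_contra! h
        have := IsSimpleModule.nontrivial B S
        obtain ⟨x, hx⟩ := exists_ne (0 : S)
        apply hx
        apply Subtype.ext
        apply Subtype.ext
        ext v
        exact LinearMap.congr_fun (h v) x
      obtain ⟨v, hv⟩ := this
      have hinj := (LinearMap.injective_or_eq_zero ((ev v).comp S.subtype)).resolve_right hv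
      have e := LinearEquiv.ofInjective _ hinj
      have := IsSimpleModule.congr e.symm
      exact ⟨e.trans (hiso _).some⟩
    exact key.isIsotypic
  · exact ⟨⟨0, 1, fun h => by
      obtain ⟨v, hv⟩ := exists_ne (0 : V)
      apply hv
      have := congrArg (fun b : B => b.1 v) h
      simpa using this.symm⟩⟩

/-- Write an irreducible ring `B` whose commutant is `K` as `M_s(D)`. The entries in `D` are
central, so they are scalars of `K`, and a nonzero vector in the image of the first matrix unit
generates a `K`-basis of `V` on which `M_s(D)` acts by the usual matrices. -/
theorem ActsIrreducibly.exists_basis_of_commutant [Finite V] [Nontrivial V]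
    {B : Subring (End K V)} (hB : ActsIrreducibly B)
    (hcomm : ∀ z : End K V, (∀ b ∈ B, z * b = b * z) → ∃ c : K, z = algebraMap K (End K V) c)
    {n : ℕ} (hn : finrank K V = n) :
    ∃ (F : Subfield K) (v : Basis (Fin n) K V),
      ∀ x : End K V, x ∈ B ↔ ∀ i j, LinearMap.toMatrix v v x i j ∈ F := by
  obtain ⟨h1, h2⟩ := hB.isSimpleRing
  obtain ⟨s, hs, D, hD, ⟨e⟩⟩ := IsSimpleRing.exists_ringEquiv_matrix_divisionRing B
  have hfinEnd : Finite (End K V) := Finite.of_injective (fun f : End K V => (f : V → V))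
    DFunLike.coe_injective
  have hfinD : Finite D := by
    refine Finite.of_injective (fun d : D => e.symm (Matrix.scalar (Fin s) d)) fun a b hab => ?_
    exact Matrix.scalar_inj.mp (e.symm.injective hab)
  have hDcomm : ∀ a b : D, a * b = b * a := (littleWedderburn D).mul_comm
  -- the embedding of `M_s(D)` in the endomorphisms of `V`
  let g : Matrix (Fin s) (Fin s) D →+* End K V := B.subtype.comp e.symm.toRingHom
  have hg : ∀ x : End K V, x ∈ B ↔ ∃ a, g a = x := by
    intro x
    constructor
    · intro hx
      exact ⟨e ⟨x, hx⟩, by simp [g]⟩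
    · rintro ⟨a, rfl⟩
      exact (e.symm a).2
  have hscal : ∀ d : D, ∃ c : K, g (Matrix.scalar (Fin s) d) = algebraMap K (End K V) c := by
    intro d
    refine hcomm _ fun b hb => ?_
    obtain ⟨a, rfl⟩ := (hg b).1 hb
    rw [← map_mul, ← map_mul]
    congr 1
    exact (Matrix.scalar_commute d (fun r => hDcomm d r) a).eq
  choose τ hτ using hscal
  have hinjK : Function.Injective (algebraMap K (End K V)) := (algebraMap K (End K V)).injective
  let t : D →+* K :=
    { toFun := τ
      map_one' := hinjK (by rw [← hτ, map_one, map_one, map_one])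
      map_zero' := hinjK (by rw [← hτ, map_zero, map_zero, map_zero])
      map_mul' := fun a b => hinjK (by rw [map_mul, ← hτ, ← hτ, ← hτ, map_mul, map_mul])
      map_add' := fun a b => hinjK (by rw [map_add, ← hτ, ← hτ, ← hτ, map_add, map_add]) }
  have ht : ∀ d, g (Matrix.scalar (Fin s) d) = algebraMap K (End K V) (t d) := hτ
  let E : Fin s → Fin s → End K V := fun i j => g (Matrix.single i j 1)
  have hE : ∀ i j k l, E i j * E k l = if j = k then E i l else 0 := by
    intro i j k l
    simp only [E, ← map_mul]
    split_ifs with h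
    · subst h; simp
    · rw [Matrix.single_mul_single_of_ne (h := h), map_zero]
  have hgE : ∀ a, g a = ∑ i, ∑ j, t (a i j) • E i j := by
    intro a
    conv_lhs => rw [Matrix.matrix_eq_sum_single a]
    simp only [map_sum]
    refine Finset.sum_congr rfl fun i _ => Finset.sum_congr rfl fun j _ => ?_
    have : Matrix.single i j (a i j) = Matrix.scalar (Fin s) (a i j) * Matrix.single i j 1 := by
      rw [Matrix.scalar_apply, ← Matrix.smul_eq_diagonal_mul, Matrix.smul_single, smul_eq_mul,
        mul_one]
    rw [this, map_mul, ht, Algebra.smul_def]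
  let i0 : Fin s := ⟨0, Nat.pos_of_ne_zero hs.out⟩
  have hgi : Function.Injective g := fun a b h => e.symm.injective (Subtype.ext h)
  have hne : E i0 i0 ≠ 0 := by
    intro h
    have := hgi (h.trans (map_zero g).symm)
    have := congrFun (congrFun this i0) i0
    simp at this
  obtain ⟨w, hw⟩ : ∃ w, E i0 i0 w ≠ 0 := by
    by_contra! h
    exact hne (LinearMap.ext h)
  let v : Fin s → V := fun i => E i i0 w
  have hEv : ∀ i j k, E i j (v k) = if j = k then v i else 0 := by
    intro i j k
    have := LinearMap.congr_fun (hE i j k i0) w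
    simp only [v]
    rw [Module.End.mul_apply] at this
    rw [this]
    split_ifs <;> rfl
  have hgv : ∀ a k, g a (v k) = ∑ i, t (a i k) • v i := by
    intro a k
    rw [hgE]
    simp [LinearMap.sum_apply, hEv]
  have hli : LinearIndependent K v := by
    rw [Fintype.linearIndependent_iff]
    intro c hc j
    have := congrArg (E i0 j) hc
    simp only [map_sum, map_smul, hEv, map_zero] at this
    simp only [smul_ite, smul_zero, Finset.sum_ite_eq, Finset.mem_univ, if_true] at this
    exact (smul_eq_zero.mp this).resolve_right hw
  have hspan : Submodule.span K (Set.range v) = ⊤ := by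
    refine (hB _ ?_).resolve_left ?_
    · intro b hb x hx
      obtain ⟨a, rfl⟩ := (hg b).1 hb
      induction hx using Submodule.span_induction with
      | mem x hx =>
        obtain ⟨k, rfl⟩ := hx
        rw [hgv]
        exact Submodule.sum_mem _ fun i _ =>
          Submodule.smul_mem _ _ (Submodule.subset_span ⟨i, rfl⟩)
      | zero => simp
      | add x y _ _ hx hy => rw [map_add]; exact add_mem hx hy
      | smul c x _ hx => rw [map_smul]; exact Submodule.smul_mem _ _ hx
    · intro h
      have : v i0 ∈ Submodule.span K (Set.range v) := Submodule.subset_span ⟨i0, rfl⟩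
      rw [h] at this
      exact hw this
  let bs : Basis (Fin s) K V := Basis.mk hli hspan.ge
  have hsn : s = n := by
    rw [← hn, finrank_eq_card_basis bs, Fintype.card_fin]
  subst hsn
  have hmat : ∀ a i j, LinearMap.toMatrix bs bs (g a) i j = t (a i j) := by
    intro a i j
    have hb : ∀ k, bs k = v k := fun k => by simp [bs]
    rw [LinearMap.toMatrix_apply, hb, hgv]
    simp only [← hb, map_sum, map_smul, Basis.repr_self]
    simp [Finsupp.single_apply]
  refine ⟨t.fieldRange, bs, fun x => ?_⟩
  rw [hg]
  constructor
  · rintro ⟨a, rfl⟩ i j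
    rw [hmat]
    exact ⟨_, rfl⟩
  · intro h
    choose a ha using h
    refine ⟨Matrix.of a, ?_⟩
    apply (LinearMap.toMatrix bs bs).injective
    ext i j
    rw [hmat, ← ha]
    rfl

end Structure

section Extension

open Module

variable {K V : Type*} [Field K] [AddCommGroup V] [Module K V]

/-- A square matrix over an extension `L` of `K`, as a `K`-linear map on column vectors. -/
def matrixEnd (K L : Type*) [Field K] [Field L] [Algebra K L] (s : ℕ) :
    Matrix (Fin s) (Fin s) L →+* End K (Fin s → L) where
  toFun a := (Matrix.toLin' a).restrictScalars K
  map_one' := by ext; simp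
  map_mul' a b := by ext; simp
  map_zero' := by ext; simp
  map_add' a b := by ext; simp

theorem finiteField_nonempty_algEquiv (K E L : Type*) [Field K] [Finite K] [Field E] [Field L]
    [Algebra K E] [Algebra K L] {r : ℕ} (hr : r ≠ 0)
    (hE : finrank K E = r) (hL : finrank K L = r) : Nonempty (E ≃ₐ[K] L) := by
  obtain ⟨p, hp⟩ := CharP.exists K
  have : Fact p.Prime := ⟨CharP.char_is_prime K p⟩
  have : NeZero r := ⟨hr⟩
  exact ⟨(FiniteField.algEquivExtension K p r E hE).trans
    (FiniteField.algEquivExtension K p r L hL).symm⟩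

/-- By Schur's lemma a non-scalar `z` in the commutant generates a field `K[z]`, over which `V` is
a vector space and `B` acts linearly. The model `L` of that field is arbitrary. -/
theorem ActsIrreducibly.exists_extension_of_commutant [Finite K] [Finite V] [Nontrivial V]
    {B : Subring (End K V)} (hB : ActsIrreducibly B) {z : End K V}
    (hzB : ∀ b ∈ B, z * b = b * z) (hz : ∀ c : K, z ≠ algebraMap K (End K V) c)
    {n : ℕ} (hn : finrank K V = n) :
    ∃ r s : ℕ, 2 ≤ r ∧ r * s = n ∧ ∀ (L : Type) [Field L] [Algebra K L], finrank K L = r →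
      ∃ φ : (Fin s → L) ≃ₗ[K] V, ∀ x ∈ B, ∃ a, φ.conj (matrixEnd K L s a) = x := by
  let S := Algebra.adjoin K {z}
  have hS : ∀ y ∈ S, ∀ b ∈ B, y * b = b * y := by
    intro y hy b hb
    have h1 : S ≤ Subalgebra.centralizer K {b} := by
      refine Algebra.adjoin_le ?_
      rintro _ rfl
      rw [SetLike.mem_coe, Subalgebra.mem_centralizer_iff]
      rintro _ rfl
      exact (hzB _ hb).symm
    exact ((Subalgebra.mem_centralizer_iff K).1 (h1 hy) b rfl).symm
  have hker : ∀ y ∈ S, y ≠ 0 → Function.Injective y := by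
    intro y hy h0
    rw [← LinearMap.ker_eq_bot]
    refine (hB (LinearMap.ker y) fun b hb w hw => ?_).resolve_right fun h => ?_
    · rw [LinearMap.mem_ker] at hw ⊢
      have := LinearMap.congr_fun (hS y hy b hb) w
      rw [Module.End.mul_apply, Module.End.mul_apply, hw, map_zero] at this
      exact this
    · exact h0 (LinearMap.ker_eq_top.mp h)
  have hfinEnd : Finite (End K V) := Finite.of_injective (fun f : End K V => (f : V → V))
    DFunLike.coe_injective
  have hdom : IsDomain S := by
    have : NoZeroDivisors S := ⟨fun {a b} hab => by
      by_contra! h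
      apply h.2
      have ha : (a : End K V) ≠ 0 := fun h' => h.1 (Subtype.ext h')
      apply Subtype.ext
      ext v
      apply hker a a.2 ha
      have := LinearMap.congr_fun (congrArg Subtype.val hab) v
      simpa using this⟩
    exact NoZeroDivisors.to_isDomain S
  let _ : Field S := (Finite.isDomain_to_isField S).toField
  have hmul : finrank K S * finrank S V = n := by rw [finrank_mul_finrank, hn]
  have hr : 2 ≤ finrank K S := by
    by_contra! h
    have h1 : finrank K S = 1 := by
      have : 0 < finrank K S := finrank_pos
      omega
    obtain ⟨c, hc⟩ := (finrank_eq_one_iff_of_nonzero' (1 : S) one_ne_zero).1 h1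
      ⟨z, Algebra.subset_adjoin rfl⟩
    apply hz c
    have := congrArg Subtype.val hc
    rw [Algebra.algebraMap_eq_smul_one]
    exact this.symm
  refine ⟨finrank K S, finrank S V, hr, hmul, fun L _ _ hL => ?_⟩
  obtain ⟨ι⟩ := finiteField_nonempty_algEquiv K S L (by omega) rfl hL
  let β : Basis (Fin (finrank S V)) S V := finBasis S V
  let φ₁ : V ≃ₗ[K] (Fin (finrank S V) → S) := β.equivFun.restrictScalars K
  let φ₂ : (Fin (finrank S V) → S) ≃ₗ[K] (Fin (finrank S V) → L) :=
    LinearEquiv.piCongrRight fun _ => ι.toLinearEquiv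
  refine ⟨(φ₁.trans φ₂).symm, fun x hx => ?_⟩
  let x' : V →ₗ[S] V :=
    { toFun := x
      map_add' := x.map_add
      map_smul' := fun y v => (LinearMap.congr_fun (hS y y.2 x hx) v).symm }
  refine ⟨(LinearMap.toMatrix β β x').map ι, ?_⟩
  have key : ∀ v, matrixEnd K L _ ((LinearMap.toMatrix β β x').map ι) ((φ₁.trans φ₂) v) =
      (φ₁.trans φ₂) (x v) := by
    intro v
    have hφ : ∀ u i, (φ₁.trans φ₂) u i = ι (β.repr u i) := fun u i => rfl
    ext i
    have h1 := congrFun (LinearMap.toMatrix_mulVec_repr β β x' v) i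
    change _ = ι (β.repr (x' v) i)
    rw [← h1]
    change ∑ j, ι _ * (φ₁.trans φ₂) v j = _
    rw [Matrix.mulVec, dotProduct, map_sum]
    exact Finset.sum_congr rfl fun j _ => by rw [hφ, map_mul]
  ext v
  rw [LinearEquiv.conj_apply_apply, LinearEquiv.symm_symm, key, LinearEquiv.symm_apply_apply]

end Extension

/-! ### Pairs of endomorphisms normalizing a matrix algebra -/

section Intertwined

open Module

variable {K V : Type*} [Field K] [AddCommGroup V] [Module K V]

/-- For a representation `ρ` of a ring `R` on a `K`-space `W`, the pairs of endomorphisms of `V`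
which leave some copy of `W` in `V` stable and act on it through `ρ(R)`. -/
def intertwinedPairs {R W : Type*} [Ring R] [AddCommGroup W] [Module K W]
    (ρ : R →+* End K W) (V : Type*) [AddCommGroup V] [Module K V] : Set (End K V × End K V) :=
  {z | ∃ f : W →ₗ[K] V, Function.Injective f ∧
    (∃ a, z.1 ∘ₗ f = f ∘ₗ ρ a) ∧ ∃ b, z.2 ∘ₗ f = f ∘ₗ ρ b}

/-- The representation of `M_n(F)`, for a subfield `F` of `K`, on the column vectors over `K`. -/
def subfieldMatrixEnd (F : Subfield K) (n : ℕ) : Matrix (Fin n) (Fin n) F →+* End K (Fin n → K) :=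
  (matrixEnd K K n).comp F.subtype.mapMatrix

theorem matrixEnd_injective (K L : Type*) [Field K] [Field L] [Algebra K L] (s : ℕ) :
    Function.Injective (matrixEnd K L s) := by
  intro a b h
  apply Matrix.toLin'.injective
  ext1 v
  exact LinearMap.ext fun w => LinearMap.congr_fun h _

theorem subfieldMatrixEnd_injective (F : Subfield K) (n : ℕ) :
    Function.Injective (subfieldMatrixEnd F n) := by
  refine (matrixEnd_injective K K n).comp ?_
  exact Matrix.map_injective F.subtype.injective

theorem mem_intertwinedPairs_of_stable [FiniteDimensional K V] {z : End K V × End K V}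
    {W : Submodule K V} (h1 : ∀ w ∈ W, z.1 w ∈ W) (h2 : ∀ w ∈ W, z.2 w ∈ W) :
    z ∈ intertwinedPairs (matrixEnd K K (finrank K W)) V := by
  let e := (finBasis K W).equivFun
  have key : ∀ x : End K V, (∀ w ∈ W, x w ∈ W) → ∃ a,
      x ∘ₗ (W.subtype ∘ₗ e.symm.toLinearMap) =
        (W.subtype ∘ₗ e.symm.toLinearMap) ∘ₗ matrixEnd K K (finrank K W) a := by
    intro x hx
    refine ⟨LinearMap.toMatrix' (e.conj (x.restrict hx)), ?_⟩
    have : matrixEnd K K (finrank K W) (LinearMap.toMatrix' (e.conj (x.restrict hx))) =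
        e.conj (x.restrict hx) := by
      change Matrix.toLin' _ = _
      rw [Matrix.toLin'_toMatrix']
    rw [this]
    ext1 v
    ext
    simp [LinearEquiv.conj_apply]
  exact ⟨W.subtype ∘ₗ e.symm.toLinearMap, W.subtype_injective.comp e.symm.injective,
    key _ h1, key _ h2⟩

/-- A proper subring of `End K V` is reducible, or commutes with a proper field extension of `K`,
or is defined over a proper subfield of `K`. -/
theorem mem_intertwinedPairs_of_ne_top [Finite K] [Finite V] [Nontrivial V]
    {B : Subring (End K V)} (hB : B ≠ ⊤) {n : ℕ} (hn : finrank K V = n)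
    {z : End K V × End K V} (h1 : z.1 ∈ B) (h2 : z.2 ∈ B) :
    (∃ d, 0 < d ∧ d < n ∧ z ∈ intertwinedPairs (matrixEnd K K d) V) ∨
    (∃ r s : ℕ, 2 ≤ r ∧ r * s = n ∧ ∀ (L : Type) [Field L] [Algebra K L], finrank K L = r →
      z ∈ intertwinedPairs (matrixEnd K L s) V) ∨
    (∃ F : Subfield K, F ≠ ⊤ ∧ z ∈ intertwinedPairs (subfieldMatrixEnd F n) V) := by
  have hfd : FiniteDimensional K V := Module.Finite.of_finite
  by_cases hirr : ActsIrreducibly B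
  · right
    by_cases hcomm : ∀ y : End K V, (∀ b ∈ B, y * b = b * y) →
        ∃ c : K, y = algebraMap K (End K V) c
    · right
      obtain ⟨F, v, hF⟩ := hirr.exists_basis_of_commutant hcomm hn
      refine ⟨F, ?_, v.equivFun.symm.toLinearMap, v.equivFun.symm.injective, ?_, ?_⟩
      · rintro rfl
        exact hB (Subring.ext fun x => by simp [hF])
      all_goals
        have key : ∀ x ∈ B, ∃ a, x ∘ₗ v.equivFun.symm.toLinearMap =
            v.equivFun.symm.toLinearMap ∘ₗ subfieldMatrixEnd F n a := by
          intro x hx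
          refine ⟨Matrix.of fun i j => ⟨_, (hF x).1 hx i j⟩, ?_⟩
          ext1 j
          ext1
          apply v.equivFun.injective
          ext i
          have hrepr := congrFun (LinearMap.toMatrix_mulVec_repr v v x (v j)) i
          simp only [LinearMap.comp_apply, LinearEquiv.coe_coe, LinearEquiv.apply_symm_apply,
            LinearMap.coe_single]
          rw [show v.equivFun.symm (Pi.single j 1) = v j by simp]
          rw [Basis.equivFun_apply, ← hrepr]
          simp only [Basis.repr_self]
          change _ = Matrix.toLin' (LinearMap.toMatrix v v x) (Pi.single j 1) i
          rw [Matrix.toLin'_apply]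
          congr 2
          ext k
          simp [Finsupp.single_apply, Pi.single_apply, eq_comm]
      · exact key _ h1
      · exact key _ h2
    · left
      push Not at hcomm
      obtain ⟨y, hy, hy'⟩ := hcomm
      obtain ⟨r, s, hr, hrs, H⟩ := hirr.exists_extension_of_commutant hy hy' hn
      refine ⟨r, s, hr, hrs, fun L _ _ hL => ?_⟩
      obtain ⟨φ, hφ⟩ := H L hL
      have key : ∀ x ∈ B, ∃ a, x ∘ₗ φ.toLinearMap = φ.toLinearMap ∘ₗ matrixEnd K L s a := by
        intro x hx
        obtain ⟨a, rfl⟩ := hφ x hx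
        refine ⟨a, ?_⟩
        ext1 j
        ext1
        simp [LinearEquiv.conj_apply]
      exact ⟨φ.toLinearMap, φ.injective, key _ h1, key _ h2⟩
  · left
    unfold ActsIrreducibly at hirr
    push Not at hirr
    obtain ⟨W, hW, hbot, htop⟩ := hirr
    refine ⟨finrank K W, ?_, ?_, mem_intertwinedPairs_of_stable (hW _ h1) (hW _ h2)⟩
    · exact Submodule.one_le_finrank_iff.mpr hbot
    · exact hn ▸ Submodule.finrank_lt htop

end Intertwined

/-! ### Sizes of general linear groups -/

theorem one_fourth_le_prod_one_sub_pow {x : ℝ} (h0 : 0 ≤ x) (h1 : x ≤ 1 / 2) (s : ℕ) :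
    1 / 4 ≤ ∏ j ∈ Finset.range s, (1 - x ^ (j + 1)) := by
  -- the error term makes the induction go through
  have key : ∀ s : ℕ, 1 / 4 + (1 / 2 : ℝ) ^ (s + 2) ≤
      ∏ j ∈ Finset.range (s + 1), (1 - x ^ (j + 1)) := by
    intro s
    induction s with
    | zero => simp; linarith
    | succ s ih =>
      rw [Finset.prod_range_succ]
      have hx : x ^ (s + 1 + 1) ≤ (1 / 2 : ℝ) ^ (s + 2) := pow_le_pow_left₀ h0 h1 _
      have hh : (1 / 2 : ℝ) ^ (s + 2) ≤ 1 / 4 := by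
        have : (1 / 2 : ℝ) ^ (s + 2) ≤ (1 / 2) ^ 2 :=
          pow_le_pow_of_le_one (by norm_num) (by norm_num) (by omega)
        linarith
      have hp : 0 < (1 / 2 : ℝ) ^ (s + 2) := by positivity
      have he : (1 / 2 : ℝ) ^ (s + 1 + 2) = (1 / 2) ^ (s + 2) / 2 := by ring
      rw [he]
      refine le_trans ?_ (mul_le_mul ih (sub_le_sub_left hx 1) (by linarith)
        (le_trans (by positivity) ih))
      nlinarith
  cases s with
  | zero => norm_num
  | succ s => exact le_trans (by have : (0 : ℝ) < (1 / 2) ^ (s + 2) := by positivity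
                                 linarith) (key s)

/-- At least a quarter of all square matrices over a finite field are invertible. -/
theorem card_matrix_le_four_mul_card_units (L : Type*) [Field L] [Finite L] (s : ℕ) :
    Nat.card L ^ (s ^ 2) ≤ 4 * Nat.card (Matrix (Fin s) (Fin s) L)ˣ := by
  cases nonempty_fintype L
  have h := Matrix.card_GL_field (𝔽 := L) s
  change Nat.card (Matrix (Fin s) (Fin s) L)ˣ = _ at h
  rw [h, Nat.card_eq_fintype_card]
  set q := Fintype.card L
  have hq : 2 ≤ q := Fintype.one_lt_card
  have hq0 : (0 : ℝ) < q := by positivity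
  have hx : (q : ℝ)⁻¹ ≤ 1 / 2 := by
    rw [inv_eq_one_div]
    exact one_div_le_one_div_of_le (by norm_num) (by exact_mod_cast hq)
  have key := one_fourth_le_prod_one_sub_pow (inv_nonneg.2 hq0.le) hx s
  have hprod : ((∏ i : Fin s, (q ^ s - q ^ (i : ℕ)) : ℕ) : ℝ) =
      (q : ℝ) ^ (s ^ 2) * ∏ j ∈ Finset.range s, (1 - (q : ℝ)⁻¹ ^ (j + 1)) := by
    rw [Fin.prod_univ_eq_prod_range (fun i => q ^ s - q ^ i) s, ← Finset.prod_range_reflect,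
      Nat.cast_prod, pow_two, pow_mul]
    conv_rhs => rw [← Finset.card_range s, ← Finset.prod_const, Finset.card_range,
      ← Finset.prod_mul_distrib]
    refine Finset.prod_congr rfl fun j hj => ?_
    have hj' : j < s := Finset.mem_range.1 hj
    rw [Nat.cast_sub (Nat.pow_le_pow_right (by omega) (by omega))]
    push_cast
    have : (q : ℝ) ^ s = q ^ (s - 1 - j) * q ^ (j + 1) := by
      rw [← pow_add]; congr 1; omega
    rw [mul_sub, mul_one, inv_pow, this, mul_assoc, mul_inv_cancel₀ (by positivity), mul_one]
  have : (q : ℝ) ^ (s ^ 2) ≤ 4 * ((∏ i : Fin s, (q ^ s - q ^ (i : ℕ)) : ℕ) : ℝ) := by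
    rw [hprod]
    have hp : (0 : ℝ) < (q : ℝ) ^ (s ^ 2) := by positivity
    nlinarith
  exact_mod_cast this

/-! ### Counting the pairs acting through a given matrix algebra -/

section Counting

open Module

theorem Set.ncard_mul_le_ncard_mul {α β : Type*} [Finite α] [Finite β] (r : α → β → Prop)
    {s : Set α} {t : Set β} {m n : ℕ} (hm : ∀ a ∈ s, m ≤ {b | b ∈ t ∧ r a b}.ncard)
    (hn : ∀ b ∈ t, {a | a ∈ s ∧ r a b}.ncard ≤ n) : s.ncard * m ≤ t.ncard * n := by
  classical
  cases nonempty_fintype α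
  cases nonempty_fintype β
  rw [Set.ncard_eq_toFinset_card' s, Set.ncard_eq_toFinset_card' t]
  refine Finset.card_mul_le_card_mul r (fun a ha => ?_) fun b hb => ?_
  · convert hm a (by simpa using ha) using 1
    rw [Set.ncard_eq_toFinset_card']
    congr 1
    ext; simp [Finset.mem_bipartiteAbove]
  · convert hn b (by simpa using hb) using 1
    rw [Set.ncard_eq_toFinset_card']
    congr 1
    ext; simp [Finset.mem_bipartiteBelow]

variable {K V : Type*} [Field K] [AddCommGroup V] [Module K V]

theorem finite_linearMap (K V W : Type*) [Field K] [AddCommGroup V] [Module K V]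
    [AddCommGroup W] [Module K W] [Finite V] [Finite W] : Finite (V →ₗ[K] W) :=
  Finite.of_injective (fun f : V →ₗ[K] W => (f : V → W)) DFunLike.coe_injective

/-- An endomorphism whose restriction to a subspace of dimension `d` is prescribed depends on
`n (n - d)` further parameters. -/
theorem ncard_comp_eq_le [Finite K] [Finite V] {W : Type*} [AddCommGroup W] [Module K W] [Finite W]
    {f c : W →ₗ[K] V} (hf : Function.Injective f) :
    {x : End K V | x ∘ₗ f = c}.ncard ≤
      Nat.card K ^ (finrank K V * (finrank K V - finrank K W)) := by
  have := finite_linearMap K V V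
  have := finite_linearMap K W V
  rcases Set.eq_empty_or_nonempty {x : End K V | x ∘ₗ f = c} with h | ⟨x₀, h₀⟩
  · simp [h]
  let r : End K V →ₗ[K] (W →ₗ[K] V) := LinearMap.lcomp K V f
  have hr : ∀ x, r x = x ∘ₗ f := fun x => rfl
  have hsurj : LinearMap.range r = ⊤ := by
    obtain ⟨g, hg⟩ := f.exists_leftInverse_of_injective (LinearMap.ker_eq_bot.2 hf)
    refine LinearMap.range_eq_top.2 fun y => ⟨y ∘ₗ g, ?_⟩
    rw [hr, LinearMap.comp_assoc, hg, LinearMap.comp_id]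
  have hdim := LinearMap.finrank_range_add_finrank_ker r
  rw [hsurj, finrank_top, finrank_linearMap, finrank_linearMap] at hdim
  have hker : Nat.card (LinearMap.ker r) =
      Nat.card K ^ (finrank K V * (finrank K V - finrank K W)) := by
    rw [natCard_eq_pow_finrank (K := K)]
    congr 1
    rw [Nat.mul_sub, mul_comm (finrank K V) (finrank K W)]
    omega
  rw [← hker, ← Nat.card_coe_set_eq]
  refine Nat.card_le_card_of_injective
    (fun x => (⟨x.1 - x₀, by rw [LinearMap.mem_ker, map_sub, hr, hr, x.2, h₀, sub_self]⟩ :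
      LinearMap.ker r)) fun x y hxy => ?_
  exact Subtype.ext (sub_left_injective (congrArg Subtype.val hxy))

/-- Count quadruples `(f, a, b, z)`. A pair `z` occurs with at least `|Rˣ|` triples `(f, a, b)`,
because the units of `R` act on these, and a triple leaves only the parameters of `ncard_comp_eq_le`
for `z`. -/
theorem ncard_intertwinedPairs_mul_card_units_le [Finite K] [Finite V] {R W : Type*} [Ring R]
    [Finite R] [AddCommGroup W] [Module K W] [Finite W] {ρ : R →+* End K W}
    (hρ : Function.Injective ρ) :
    (intertwinedPairs ρ V).ncard * Nat.card Rˣ ≤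
      Nat.card K ^ (finrank K W * finrank K V) * Nat.card R ^ 2 *
        Nat.card K ^ (2 * (finrank K V * (finrank K V - finrank K W))) := by
  have := finite_linearMap K V V
  have := finite_linearMap K W V
  let t : Set ((W →ₗ[K] V) × R × R) := {y | Function.Injective y.1}
  have ht : t.ncard ≤ Nat.card K ^ (finrank K W * finrank K V) * Nat.card R ^ 2 := by
    refine (Set.ncard_le_card t).trans (le_of_eq ?_)
    rw [Nat.card_prod, Nat.card_prod, natCard_eq_pow_finrank (K := K) (V := W →ₗ[K] V),
      finrank_linearMap, pow_two]
  refine le_trans (Set.ncard_mul_le_ncard_mul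
    (fun z y => z.1 ∘ₗ y.1 = y.1 ∘ₗ ρ y.2.1 ∧ z.2 ∘ₗ y.1 = y.1 ∘ₗ ρ y.2.2)
    (t := t) (n := Nat.card K ^ (2 * (finrank K V * (finrank K V - finrank K W)))) ?_ ?_)
    (Nat.mul_le_mul_right _ ht)
  · rintro z ⟨f, hf, ⟨a, ha⟩, b, hb⟩
    rw [← Nat.card_coe_set_eq]
    have hunit : ∀ h : Rˣ, (ρ h) * ρ ((h⁻¹ : Rˣ) : R) = 1 ∧ ρ ((h⁻¹ : Rˣ) : R) * ρ h = 1 :=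
      fun h => by rw [← map_mul, ← map_mul, Units.mul_inv, Units.inv_mul, map_one]; exact ⟨rfl, rfl⟩
    have hcomm : ∀ (x : End K V) (c : R) (h : Rˣ), x ∘ₗ f = f ∘ₗ ρ c →
        x ∘ₗ (f ∘ₗ ρ h) = (f ∘ₗ ρ h) ∘ₗ ρ (((h⁻¹ : Rˣ) : R) * c * h) := by
      intro x c h hx
      rw [← LinearMap.comp_assoc, hx, LinearMap.comp_assoc, LinearMap.comp_assoc]
      congr 1
      rw [← Module.End.mul_eq_comp, ← Module.End.mul_eq_comp, ← map_mul, ← map_mul]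
      congr 1
      rw [mul_assoc, Units.mul_inv_cancel_left]
    have hinj : ∀ h : Rˣ, Function.Injective (ρ h) := fun h =>
      Function.LeftInverse.injective (g := ρ ((h⁻¹ : Rˣ) : R)) fun w =>
        LinearMap.congr_fun (hunit h).2 w
    refine Nat.card_le_card_of_injective (fun h : Rˣ =>
      (⟨(f ∘ₗ ρ h, ((h⁻¹ : Rˣ) : R) * a * h, ((h⁻¹ : Rˣ) : R) * b * h), hf.comp (hinj h),
        hcomm _ _ h ha, hcomm _ _ h hb⟩ : {y | y ∈ t ∧ _})) fun h h' hh => ?_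
    have h1 : f ∘ₗ ρ h = f ∘ₗ ρ h' := congrArg (fun y => y.1.1) hh
    apply Units.ext
    apply hρ
    ext w
    exact hf (LinearMap.congr_fun h1 w)
  · rintro ⟨f, a, b⟩ hf
    have hf' : Function.Injective f := hf
    refine (Set.ncard_le_ncard (t := {x : End K V | x ∘ₗ f = f ∘ₗ ρ a} ×ˢ
      {x : End K V | x ∘ₗ f = f ∘ₗ ρ b}) (fun z hz => hz.2) (Set.toFinite _)).trans ?_
    rw [Set.ncard_prod, mul_comm 2, pow_mul, pow_two]
    exact Nat.mul_le_mul (ncard_comp_eq_le hf') (ncard_comp_eq_le hf')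

theorem ncard_intertwinedPairs_le [Finite K] [Finite V] {L W : Type*} [Field L] [Finite L] {s : ℕ}
    [AddCommGroup W] [Module K W] [Finite W] {ρ : Matrix (Fin s) (Fin s) L →+* End K W}
    (hρ : Function.Injective ρ) :
    (intertwinedPairs ρ V).ncard ≤
      4 * (Nat.card K ^ (finrank K W * finrank K V +
        2 * (finrank K V * (finrank K V - finrank K W))) * Nat.card L ^ (s ^ 2)) := by
  have h := ncard_intertwinedPairs_mul_card_units_le (V := V) hρ
  have hu := card_matrix_le_four_mul_card_units L s
  have hR : Nat.card (Matrix (Fin s) (Fin s) L) = Nat.card L ^ (s ^ 2) := by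
    rw [natCard_eq_pow_finrank (K := L), finrank_matrix]
    simp [pow_two]
  rw [hR] at h
  have hpos : 0 < Nat.card L ^ (s ^ 2) := pow_pos Nat.card_pos _
  refine Nat.le_of_mul_le_mul_right ?_ hpos
  calc (intertwinedPairs ρ V).ncard * Nat.card L ^ (s ^ 2)
      ≤ (intertwinedPairs ρ V).ncard * (4 * Nat.card (Matrix (Fin s) (Fin s) L)ˣ) :=
        Nat.mul_le_mul_left _ hu
    _ = 4 * ((intertwinedPairs ρ V).ncard * Nat.card (Matrix (Fin s) (Fin s) L)ˣ) := by ring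
    _ ≤ 4 * _ := Nat.mul_le_mul_left _ h
    _ = _ := by rw [pow_add]; ring

end Counting

/-! ### Counting the pairs that do not generate -/

section Total

open Module

theorem Subfield.eq_of_natCard_eq {K : Type*} [Field K] [Finite K] {F F' : Subfield K}
    (h : Nat.card F = Nat.card F') : F = F' := by
  classical
  -- both are the set of roots of `X ^ q - X`
  have key : ∀ E : Subfield K, (E : Set K) = {x : K | x ^ Nat.card E = x} := by
    intro E
    cases nonempty_fintype E
    have hq : 1 < Nat.card E := Finite.one_lt_card
    have hne := FiniteField.X_pow_card_sub_X_ne_zero K hq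
    have hset : {x : K | x ^ Nat.card E = x} =
        ((Polynomial.X ^ Nat.card E - Polynomial.X : Polynomial K).roots.toFinset : Set K) := by
      ext x
      rw [Finset.mem_coe, Multiset.mem_toFinset, Polynomial.mem_roots hne]
      simp [sub_eq_zero]
    refine Set.eq_of_subset_of_ncard_le (fun x hx => ?_) ?_ (Set.toFinite _)
    · have := congrArg Subtype.val (FiniteField.pow_card (⟨x, hx⟩ : E))
      rw [← Nat.card_eq_fintype_card] at this
      exact this
    · rw [hset, Set.ncard_coe_finset]
      refine (Multiset.toFinset_card_le _).trans ((Polynomial.card_roots' _).trans ?_)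
      rw [FiniteField.X_pow_card_sub_X_natDegree_eq K hq]
      exact le_of_eq (Nat.card_coe_set_eq _)
  apply SetLike.coe_injective
  rw [key F, key F', h]

theorem Subfield.natCard_le (K : Type*) [Field K] [Finite K] :
    Nat.card (Subfield K) ≤ Nat.card K := by
  have hle : ∀ F : Subfield K, Nat.card F - 1 < Nat.card K := fun F => by
    have h1 : Nat.card F ≤ Nat.card K := Nat.card_le_card_of_injective _ F.subtype.injective
    have h2 : 0 < Nat.card F := Nat.card_pos
    omega
  have := Nat.card_le_card_of_injective
    (fun F : Subfield K => (⟨Nat.card F - 1, hle F⟩ : Fin (Nat.card K))) fun F F' h => by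
      have h1 : 0 < Nat.card F := Nat.card_pos
      have h2 : 0 < Nat.card F' := Nat.card_pos
      have h3 : Nat.card F - 1 = Nat.card F' - 1 := congrArg Fin.val h
      exact Subfield.eq_of_natCard_eq (by omega)
  simpa using this

theorem Subfield.natCard_sq_le_of_ne_top {K : Type*} [Field K] [Finite K] {F : Subfield K}
    (hF : F ≠ ⊤) : Nat.card F ^ 2 ≤ Nat.card K := by
  rw [natCard_eq_pow_finrank (K := F) (V := K)]
  refine Nat.pow_le_pow_right Nat.card_pos ?_
  by_contra! h
  have h1 : finrank F K = 1 := by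
    have : 0 < finrank F K := finrank_pos
    omega
  apply hF
  rw [eq_top_iff]
  intro x _
  obtain ⟨c, hc⟩ := (finrank_eq_one_iff_of_nonzero' (1 : K) one_ne_zero).1 h1 x
  rw [← hc, Subfield.smul_def, smul_eq_mul, mul_one]
  exact c.2

variable {K V : Type*} [Field K] [Finite K] [AddCommGroup V] [Module K V] [Finite V]

theorem ncard_intertwinedPairs_matrixEnd_self_le {n d : ℕ} (hn : finrank K V = n) (hd : 0 < d)
    (hdn : d < n) :
    (intertwinedPairs (matrixEnd K K d) V).ncard * Nat.card K ^ (n - 1) ≤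
      4 * Nat.card K ^ (2 * n ^ 2) := by
  have h := ncard_intertwinedPairs_le (V := V) (matrixEnd_injective K K d)
  rw [hn, finrank_fin_fun, ← pow_add] at h
  refine (Nat.mul_le_mul_right _ h).trans ?_
  rw [mul_assoc, ← pow_add]
  refine Nat.mul_le_mul_left _ (Nat.pow_le_pow_right Nat.card_pos ?_)
  obtain ⟨e, rfl⟩ := Nat.exists_eq_add_of_lt hdn
  obtain ⟨d, rfl⟩ := Nat.exists_eq_succ_of_ne_zero hd.ne'
  simp only [Nat.succ_eq_add_one]
  rw [show d + 1 + e + 1 - 1 = d + e + 1 by omega, show d + 1 + e + 1 - (d + 1) = e + 1 by omega]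
  nlinarith

theorem ncard_intertwinedPairs_of_finrank_eq_le {L W : Type*} [Field L] [Finite L] {s n : ℕ}
    [AddCommGroup W] [Module K W] [Finite W] {ρ : Matrix (Fin s) (Fin s) L →+* End K W}
    (hρ : Function.Injective ρ) (hn : finrank K V = n) (hW : finrank K W = n) (hn0 : 0 < n)
    (hL : Nat.card L ^ (s ^ 2) ≤ Nat.card K ^ (n * (n - 1))) :
    (intertwinedPairs ρ V).ncard * Nat.card K ^ n ≤ 4 * Nat.card K ^ (2 * n ^ 2) := by
  have h := ncard_intertwinedPairs_le (V := V) hρ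
  rw [hn, hW, Nat.sub_self, Nat.mul_zero, Nat.mul_zero, Nat.add_zero] at h
  refine (Nat.mul_le_mul_right _ (h.trans
    (Nat.mul_le_mul_left 4 (Nat.mul_le_mul_left _ hL)))).trans (le_of_eq ?_)
  rw [← pow_add, mul_assoc, ← pow_add]
  congr 2
  obtain ⟨n, rfl⟩ := Nat.exists_eq_succ_of_ne_zero hn0.ne'
  simp only [Nat.succ_eq_add_one, Nat.add_sub_cancel]
  ring

/-- All but a share `12 n |K| ^ (1 - n)` of the pairs of endomorphisms lie in no proper subring. The
exponent is that of the pairs with a common invariant line or hyperplane; no other type of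
maximal subring contributes a larger power of `|K|`. -/
theorem ncard_pairs_in_proper_subring_le [Nontrivial V] {n : ℕ} (hn : finrank K V = n)
    (hn2 : 2 ≤ n) :
    {z : End K V × End K V | ∃ B : Subring (End K V), B ≠ ⊤ ∧ z.1 ∈ B ∧ z.2 ∈ B}.ncard *
      Nat.card K ^ (n - 1) ≤ 12 * n * Nat.card K ^ (2 * n ^ 2) := by
  classical
  have := finite_linearMap K V V
  set Q := Nat.card K
  have hQ : 0 < Q := Nat.card_pos
  let T : ℕ → Set (End K V × End K V) := fun d =>
    if 0 < d ∧ d < n then intertwinedPairs (matrixEnd K K d) V else ∅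
  let U : ℕ → Set (End K V × End K V) := fun r =>
    {z | 2 ≤ r ∧ ∃ s, r * s = n ∧ ∀ (L : Type) [Field L] [Algebra K L], finrank K L = r →
      z ∈ intertwinedPairs (matrixEnd K L s) V}
  let S : Subfield K → Set (End K V × End K V) := fun F =>
    if F = ⊤ then ∅ else intertwinedPairs (subfieldMatrixEnd F n) V
  have hT : ∀ d, (T d).ncard * Q ^ (n - 1) ≤ 4 * Q ^ (2 * n ^ 2) := by
    intro d
    simp only [T]
    split_ifs with h
    · exact ncard_intertwinedPairs_matrixEnd_self_le hn h.1 h.2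
    · simp
  have hU : ∀ r, (U r).ncard * Q ^ (n - 1) ≤ 4 * Q ^ (2 * n ^ 2) := by
    intro r
    rcases Set.eq_empty_or_nonempty (U r) with h | ⟨z, hr, s, hrs, -⟩
    · simp [h]
    obtain ⟨p, hp⟩ := CharP.exists K
    have : Fact p.Prime := ⟨CharP.char_is_prime K p⟩
    have : NeZero r := ⟨by omega⟩
    have hsub : U r ⊆ intertwinedPairs (matrixEnd K (FiniteField.Extension K p r) s) V := by
      rintro z ⟨-, s', hs', H⟩
      have : s' = s := Nat.eq_of_mul_eq_mul_left (by omega) (hs'.trans hrs.symm)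
      subst this
      exact H _ (FiniteField.finrank_extension K p r)
    have : Finite (FiniteField.Extension K p r) := Module.finite_of_finite K
    have h1 := ncard_intertwinedPairs_of_finrank_eq_le (V := V) (n := n)
      (matrixEnd_injective K (FiniteField.Extension K p r) s) hn
      (by rw [finrank_pi_fintype]; simp [FiniteField.finrank_extension, ← hrs, mul_comm])
      (by omega) (by
        rw [FiniteField.natCard_extension, ← pow_mul]
        refine Nat.pow_le_pow_right hQ ?_
        rw [pow_two, ← mul_assoc, hrs]
        refine Nat.mul_le_mul_left _ ?_
        have : 2 * s ≤ n := hrs ▸ Nat.mul_le_mul_right s hr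
        omega)
    exact (Nat.mul_le_mul (Set.ncard_le_ncard hsub (Set.toFinite _))
      (Nat.pow_le_pow_right hQ (by omega))).trans h1
  have hS : ∀ F, (S F).ncard * Q ^ n ≤ 4 * Q ^ (2 * n ^ 2) := by
    intro F
    simp only [S]
    split_ifs with h
    · simp
    · refine ncard_intertwinedPairs_of_finrank_eq_le (subfieldMatrixEnd_injective F n) hn
        (finrank_fin_fun K) (by omega) ?_
      have h1 : n ^ 2 ≤ 2 * (n * (n - 1)) := by
        obtain ⟨m, rfl⟩ := Nat.exists_eq_add_of_le hn2
        rw [show 2 + m - 1 = m + 1 by omega]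
        nlinarith
      calc Nat.card F ^ (n ^ 2) ≤ Nat.card F ^ (2 * (n * (n - 1))) :=
            Nat.pow_le_pow_right Nat.card_pos h1
        _ = (Nat.card F ^ 2) ^ (n * (n - 1)) := pow_mul _ _ _
        _ ≤ Q ^ (n * (n - 1)) := Nat.pow_le_pow_left (Subfield.natCard_sq_le_of_ne_top h) _
  cases nonempty_fintype (Subfield K)
  have hcover : {z : End K V × End K V | ∃ B : Subring (End K V), B ≠ ⊤ ∧ z.1 ∈ B ∧ z.2 ∈ B} ⊆
      (⋃ d ∈ Finset.range n, T d) ∪ (⋃ r ∈ Finset.range (n + 1), U r) ∪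
        ⋃ F ∈ (Finset.univ : Finset (Subfield K)), S F := by
    rintro z ⟨B, hB, h1, h2⟩
    rcases mem_intertwinedPairs_of_ne_top hB hn h1 h2 with
      ⟨d, hd, hdn, h⟩ | ⟨r, s, hr, hrs, h⟩ | ⟨F, hF, h⟩
    · refine Or.inl (Or.inl (Set.mem_biUnion (x := d) (by simpa using hdn) ?_))
      simpa [T, hd, hdn] using h
    · have : r ≤ n := Nat.le_of_dvd (by omega) ⟨s, hrs.symm⟩
      exact Or.inl (Or.inr (Set.mem_biUnion (x := r) (by simp; omega) ⟨hr, s, hrs, h⟩))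
    · refine Or.inr (Set.mem_biUnion (x := F) (by simp) ?_)
      simpa [S, hF] using h
  have h1 := Set.ncard_le_ncard hcover (Set.toFinite _)
  have h2 := (Set.ncard_union_le ((⋃ d ∈ Finset.range n, T d) ∪ (⋃ r ∈ Finset.range (n + 1), U r))
    (⋃ F ∈ (Finset.univ : Finset (Subfield K)), S F))
  have h3 := Set.ncard_union_le (⋃ d ∈ Finset.range n, T d) (⋃ r ∈ Finset.range (n + 1), U r)
  have hT' : (⋃ d ∈ Finset.range n, T d).ncard * Q ^ (n - 1) ≤ n * (4 * Q ^ (2 * n ^ 2)) := by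
    refine (Nat.mul_le_mul_right _ (Finset.set_ncard_biUnion_le _ _)).trans ?_
    rw [Finset.sum_mul]
    simpa using Finset.sum_le_card_nsmul (Finset.range n) _ _ fun d _ => hT d
  have hU' : (⋃ d ∈ Finset.range (n + 1), U d).ncard * Q ^ (n - 1) ≤
      (n + 1) * (4 * Q ^ (2 * n ^ 2)) := by
    refine (Nat.mul_le_mul_right _ (Finset.set_ncard_biUnion_le _ _)).trans ?_
    rw [Finset.sum_mul]
    simpa using Finset.sum_le_card_nsmul (Finset.range (n + 1)) _ _ fun d _ => hU d
  have hS' : (⋃ F ∈ (Finset.univ : Finset (Subfield K)), S F).ncard * Q ^ (n - 1) ≤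
      4 * Q ^ (2 * n ^ 2) := by
    refine Nat.le_of_mul_le_mul_right ?_ hQ
    rw [mul_assoc, ← pow_succ, Nat.sub_add_cancel (by omega)]
    refine (Nat.mul_le_mul_right _ (Finset.set_ncard_biUnion_le _ _)).trans ?_
    rw [Finset.sum_mul]
    refine (Finset.sum_le_card_nsmul _ _ _ fun F _ => hS F).trans ?_
    rw [Finset.card_univ, ← Nat.card_eq_fintype_card, smul_eq_mul, mul_comm]
    exact Nat.mul_le_mul_left _ (Subfield.natCard_le K)
  have h4 := Nat.mul_le_mul_right (Q ^ (n - 1)) (h1.trans (h2.trans (Nat.add_le_add_right h3 _)))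
  rw [add_mul, add_mul] at h4
  have h5 : 2 * Q ^ (2 * n ^ 2) ≤ n * Q ^ (2 * n ^ 2) := Nat.mul_le_mul_right _ hn2
  nlinarith

end Total

/-! ### Matrices of small rank -/

section SmallRank

open Module Matrix

theorem exists_common_kernel_vector {K : Type*} [Field K] {n : ℕ} {x y : Matrix (Fin n) (Fin n) K}
    (h : x.rank + y.rank < n) : ∃ v ≠ 0, x *ᵥ v = 0 ∧ y *ᵥ v = 0 := by
  have hx := LinearMap.finrank_range_add_finrank_ker x.mulVecLin
  have hy := LinearMap.finrank_range_add_finrank_ker y.mulVecLin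
  rw [finrank_fin_fun] at hx hy
  have h1 := Submodule.finrank_sup_add_finrank_inf_eq (LinearMap.ker x.mulVecLin)
    (LinearMap.ker y.mulVecLin)
  have h2 := Submodule.finrank_le (LinearMap.ker x.mulVecLin ⊔ LinearMap.ker y.mulVecLin)
  rw [finrank_fin_fun] at h2
  unfold Matrix.rank at h
  have h3 : LinearMap.ker x.mulVecLin ⊓ LinearMap.ker y.mulVecLin ≠ ⊥ := by
    rw [← Submodule.one_le_finrank_iff]
    omega
  obtain ⟨v, hv, hv0⟩ := Submodule.exists_mem_ne_zero_of_ne_bot h3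
  exact ⟨v, hv0, hv.1, hv.2⟩

theorem adjoin_ne_top_of_common_kernel_vector (k : Type*) {K : Type*} [Field k] [Field K]
    [Algebra k K] {n : ℕ} (hn : 1 < n) {x y : Matrix (Fin n) (Fin n) K} {v : Fin n → K}
    (hv : v ≠ 0) (hx : x *ᵥ v = 0) (hy : y *ᵥ v = 0) : Algebra.adjoin k {x, y} ≠ ⊤ := by
  intro htop
  -- `v` is an eigenvector of every element of the algebra generated by `x` and `y`
  have key : ∀ a ∈ Algebra.adjoin k {x, y}, ∃ c : K, a *ᵥ v = c • v := by
    intro a ha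
    induction ha using Algebra.adjoin_induction with
    | mem a ha =>
      rcases ha with rfl | rfl
      · exact ⟨0, by rw [hx, zero_smul]⟩
      · exact ⟨0, by rw [hy, zero_smul]⟩
    | algebraMap c =>
      refine ⟨algebraMap k K c, ?_⟩
      rw [Algebra.algebraMap_eq_smul_one, smul_mulVec, one_mulVec, algebraMap_smul]
    | add a b _ _ ha hb =>
      obtain ⟨c, hc⟩ := ha
      obtain ⟨d, hd⟩ := hb
      exact ⟨c + d, by rw [add_mulVec, hc, hd, add_smul]⟩
    | mul a b _ _ ha hb =>
      obtain ⟨c, hc⟩ := ha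
      obtain ⟨d, hd⟩ := hb
      exact ⟨d * c, by rw [← mulVec_mulVec, hd, mulVec_smul, hc, smul_smul]⟩
  obtain ⟨i, hi⟩ := Function.ne_iff.1 hv
  have : Nontrivial (Fin n) := Fin.nontrivial_iff_two_le.2 hn
  obtain ⟨j, hj⟩ := exists_ne i
  obtain ⟨c, hc⟩ := key (single j i 1) (htop ▸ Algebra.mem_top)
  have h1 := congrFun hc i
  have h2 := congrFun hc j
  simp only [single_mulVec, Pi.smul_apply, smul_eq_mul, one_mul] at h1 h2
  rw [Function.update_of_ne hj.symm] at h1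
  rw [Function.update_self] at h2
  have hc0 : c = 0 := by
    rcases mul_eq_zero.1 h1.symm with h | h
    · exact h
    · exact absurd h hi
  rw [hc0, zero_mul] at h2
  exact hi h2

theorem adjoin_pair_self_ne_top (k : Type*) {K : Type*} [Field k] [Field K]
    [Algebra k K] {n : ℕ} (hn : 1 < n) (x : Matrix (Fin n) (Fin n) K) :
    Algebra.adjoin k {x, x} ≠ ⊤ := by
  intro htop
  have hcomm : IsMulCommutative (Algebra.adjoin k {x, x}) :=
    Algebra.isMulCommutative_adjoin k (by rintro a (rfl | rfl) b (rfl | rfl) <;> rfl)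
  have hmul : ∀ a b : Matrix (Fin n) (Fin n) K, a * b = b * a := fun a b =>
    congrArg Subtype.val (hcomm.is_comm.comm (⟨a, htop ▸ Algebra.mem_top⟩ : Algebra.adjoin k {x, x})
      ⟨b, htop ▸ Algebra.mem_top⟩)
  have : Nontrivial (Fin n) := Fin.nontrivial_iff_two_le.2 hn
  obtain ⟨i, j, hij⟩ := exists_pair_ne (Fin n)
  have h := hmul (single i j 1) (single j j 1)
  rw [single_mul_single_same, single_mul_single_of_ne (h := hij.symm)] at h
  have := congrFun (congrFun h i) j
  simp at this

theorem natCard_matrix_fin (K : Type*) [Field K] (m n : ℕ) :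
    Nat.card (Matrix (Fin m) (Fin n) K) = Nat.card K ^ (m * n) := by
  rw [natCard_eq_pow_finrank (K := K), finrank_matrix]
  simp

theorem rankGenProb_le {k K : Type*} [Field k] [Field K] [Finite K] [Algebra k K]
    {n p α : ℕ} (hn : 1 < n) (hp : p.Prime) (hα : α * p ≤ n) :
    rankGenProb k K n α ≤ 1 - ((Nat.card K : ℝ) ^ (2 * p * α ^ 2))⁻¹ := by
  have hQ : (1 : ℝ) ≤ Nat.card K := by exact_mod_cast Nat.card_pos
  have hinv : ((Nat.card K : ℝ) ^ (2 * p * α ^ 2))⁻¹ ≤ 1 := inv_le_one_of_one_le₀ (one_le_pow₀ hQ)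
  rcases Nat.lt_or_ge (2 * α) n with h | h
  · have : rankGeneratingPairs k K n α = ∅ := by
      refine Set.eq_empty_iff_forall_notMem.2 fun z ⟨h1, h2, h3⟩ => ?_
      have h1' : z.1.rank = α := h1
      have h2' : z.2.rank = α := h2
      obtain ⟨v, hv, hx, hy⟩ := exists_common_kernel_vector (x := z.1) (y := z.2) (by omega)
      exact adjoin_ne_top_of_common_kernel_vector k hn hv hx hy h3
    rw [rankGenProb, this, Set.ncard_empty, Nat.cast_zero, zero_div]
    linarith
  · have hp2 := hp.two_le
    have hα2 : α * 2 = n := le_antisymm ((Nat.mul_le_mul_left α hp2).trans hα) (by omega)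
    have hp' : p = 2 := by
      refine le_antisymm ?_ hp2
      have h0 : 0 < α := by omega
      exact Nat.le_of_mul_le_mul_left (hα.trans hα2.ge) h0
    subst hp'
    set a := (rankSet K n α).ncard
    -- the pairs `(x, x)` do not generate
    have hcount : (rankGeneratingPairs k K n α).ncard + a ≤ a ^ 2 := by
      have hd : Set.ncard ((fun x => (x, x)) '' rankSet K n α) = a :=
        Set.ncard_image_of_injective _ fun x y h => congrArg Prod.fst h
      rw [← hd, ← Set.ncard_union_eq _ (Set.toFinite _) (Set.toFinite _), hd, pow_two,
        ← Set.ncard_prod]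
      · refine Set.ncard_le_ncard ?_ (Set.toFinite _)
        rintro z (⟨h1, h2, -⟩ | ⟨x, hx, rfl⟩)
        · exact ⟨h1, h2⟩
        · exact ⟨hx, hx⟩
      · rw [Set.disjoint_left]
        rintro z ⟨-, -, h3⟩ ⟨x, hx, rfl⟩
        exact adjoin_pair_self_ne_top k hn x h3
    have ha : a ≤ Nat.card K ^ (2 * 2 * α ^ 2) := by
      refine (Set.ncard_le_card _).trans (le_of_eq ?_)
      rw [natCard_matrix_fin, ← hα2]
      congr 1
      ring
    rw [rankGenProb]
    change _ / (a : ℝ) ^ 2 ≤ _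
    rcases Nat.eq_zero_or_pos a with h0 | h0
    · rw [h0]
      simp only [Nat.cast_zero, ne_eq, OfNat.ofNat_ne_zero, not_false_eq_true, zero_pow, div_zero]
      linarith
    · have h0' : (0 : ℝ) < a := by exact_mod_cast h0
      have h1 : (((rankGeneratingPairs k K n α).ncard : ℝ)) + a ≤ a ^ 2 := by exact_mod_cast hcount
      have h2 : ((Nat.card K : ℝ) ^ (2 * 2 * α ^ 2))⁻¹ ≤ (a : ℝ)⁻¹ :=
        inv_anti₀ h0' (by exact_mod_cast ha)
      have h3 : ((rankGeneratingPairs k K n α).ncard : ℝ) / (a : ℝ) ^ 2 ≤ 1 - (a : ℝ)⁻¹ := by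
        rw [div_le_iff₀ (by positivity)]
        field_simp
        linarith
      linarith

end SmallRank

/-! ### The number of matrices of given rank -/

section RankCount

open Module Matrix

/-- The matrices with an invertible upper left `α × α` block and rank `α` are determined by
their first `α` rows and columns. -/
theorem card_matrix_le_mul_ncard_rankSet (K : Type*) [Field K] [Finite K] (α c : ℕ) :
    Nat.card K ^ ((α + c) ^ 2) ≤
      4 * Nat.card K ^ (c ^ 2) * (rankSet K (α + c) α).ncard := by
  let e : Fin α ⊕ Fin c ≃ Fin (α + c) := finSumFinEquiv
  let M : (Matrix (Fin α) (Fin α) K)ˣ × Matrix (Fin α) (Fin c) K × Matrix (Fin c) (Fin α) K →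
      Matrix (Fin (α + c)) (Fin (α + c)) K := fun y =>
    reindex e e (fromRows 1 y.2.2 * fromCols (y.1 : Matrix (Fin α) (Fin α) K) y.2.1)
  have hM : ∀ y, M y ∈ rankSet K (α + c) α := by
    rintro ⟨g, u, w⟩
    change (reindex e e _).rank = α
    rw [rank_reindex]
    refine le_antisymm ((rank_mul_le_left _ _).trans
      ((rank_le_card_width _).trans_eq (Fintype.card_fin α))) ?_
    have hg : (fromCols 1 0 : Matrix (Fin α) (Fin α ⊕ Fin c) K) *
        ((fromRows 1 w : Matrix (Fin α ⊕ Fin c) (Fin α) K) *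
          fromCols (g : Matrix (Fin α) (Fin α) K) u) *
        (fromRows 1 0 : Matrix (Fin α ⊕ Fin c) (Fin α) K) =
          (g : Matrix (Fin α) (Fin α) K) := by
      rw [← Matrix.mul_assoc, fromCols_mul_fromRows, Matrix.mul_assoc, fromCols_mul_fromRows]
      simp
    have h1 : (g : Matrix (Fin α) (Fin α) K).rank = α := by
      rw [rank_of_isUnit _ g.isUnit, Fintype.card_fin]
    conv_lhs => rw [← h1, ← hg]
    exact (rank_mul_le_left _ _).trans (rank_mul_le_right _ _)
  have hinj : Function.Injective M := by
    rintro ⟨g, u, w⟩ ⟨g', u', w'⟩ h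
    have h1 := (reindex e e).injective h
    simp only [fromRows_mul_fromCols, fromBlocks_inj, Matrix.one_mul] at h1
    obtain ⟨hg, hu, hw, -⟩ := h1
    have hg' : g = g' := Units.ext hg
    subst hg'
    have hw' : w = w' := by
      have := congrArg (· * ((g⁻¹ : (Matrix (Fin α) (Fin α) K)ˣ) : Matrix (Fin α) (Fin α) K)) hw
      simpa [Matrix.mul_assoc] using this
    rw [hu, hw']
  have h1 : Nat.card ((Matrix (Fin α) (Fin α) K)ˣ × Matrix (Fin α) (Fin c) K ×
      Matrix (Fin c) (Fin α) K) ≤ (rankSet K (α + c) α).ncard := by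
    rw [← Nat.card_coe_set_eq]
    exact Nat.card_le_card_of_injective (fun y => (⟨M y, hM y⟩ : rankSet K (α + c) α))
      fun y y' h => hinj (congrArg Subtype.val h)
  rw [Nat.card_prod, Nat.card_prod, natCard_matrix_fin, natCard_matrix_fin, ← pow_add] at h1
  calc Nat.card K ^ ((α + c) ^ 2)
      = Nat.card K ^ (α ^ 2) * (Nat.card K ^ (c ^ 2) * Nat.card K ^ (α * c + c * α)) := by
        rw [← pow_add, ← pow_add]; congr 1; ring
    _ ≤ 4 * Nat.card (Matrix (Fin α) (Fin α) K)ˣ *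
          (Nat.card K ^ (c ^ 2) * Nat.card K ^ (α * c + c * α)) :=
        Nat.mul_le_mul_right _ (card_matrix_le_four_mul_card_units K α)
    _ = 4 * Nat.card K ^ (c ^ 2) * (Nat.card (Matrix (Fin α) (Fin α) K)ˣ *
          Nat.card K ^ (α * c + c * α)) := by ring
    _ ≤ _ := Nat.mul_le_mul_left _ h1

end RankCount

/-! ### Matrices of large rank -/

section LargeRank

open Module

theorem exists_ncard_rankSet_sq_eq_add {k K : Type*} [Field k] [Field K] [Finite K] [Algebra k K]
    {n : ℕ} (hn : 2 ≤ n) (α : ℕ) :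
    ∃ b : ℕ, (rankSet K n α).ncard ^ 2 = (rankGeneratingPairs k K n α).ncard + b ∧
      b * Nat.card K ^ (n - 1) ≤ 12 * n * Nat.card K ^ (2 * n ^ 2) := by
  have : Nontrivial (Fin n) := Fin.nontrivial_iff_two_le.2 hn
  have := finite_linearMap K (Fin n → K) (Fin n → K)
  have hsub : rankGeneratingPairs k K n α ⊆ rankSet K n α ×ˢ rankSet K n α :=
    fun z hz => ⟨hz.1, hz.2.1⟩
  refine ⟨((rankSet K n α ×ˢ rankSet K n α) \ rankGeneratingPairs k K n α).ncard, ?_, ?_⟩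
  · rw [pow_two, ← Set.ncard_prod, add_comm, Set.ncard_sdiff_add_ncard_of_subset hsub]
  · refine (Nat.mul_le_mul_right _ ?_).trans
      (ncard_pairs_in_proper_subring_le (K := K) (V := Fin n → K) (finrank_fin_fun K) hn)
    let e := (Matrix.toLinAlgEquiv' (R := K) (n := Fin n)).toRingEquiv
    refine Set.ncard_le_ncard_of_injOn (Prod.map e e) ?_
      (e.injective.prodMap e.injective).injOn (Set.toFinite _)
    rintro z ⟨⟨h1, h2⟩, h3⟩
    refine ⟨(Algebra.adjoin k {z.1, z.2}).toSubring.map (e : _ →+* _), fun htop => ?_, ?_, ?_⟩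
    · refine h3 ⟨h1, h2, ?_⟩
      rw [eq_top_iff]
      intro x _
      have hx : e x ∈ (Algebra.adjoin k {z.1, z.2}).toSubring.map (e : _ →+* _) := by
        rw [htop]; exact Subring.mem_top _
      obtain ⟨y, hy, hyx⟩ := hx
      have : y = x := e.injective hyx
      exact this ▸ hy
    · exact ⟨z.1, Algebra.subset_adjoin (by simp), rfl⟩
    · exact ⟨z.2, Algebra.subset_adjoin (by simp), rfl⟩

theorem sq_le_two_mul_two_pow (e : ℕ) : e ^ 2 ≤ 2 * 2 ^ e := by
  rcases Nat.lt_or_ge e 4 with h | h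
  · interval_cases e <;> norm_num
  · induction e, h using Nat.le_induction with
    | base => norm_num
    | succ e he ih => rw [pow_succ 2 e]; nlinarith

/-- The exponent `e` is what remains of `n - 1` after paying for the small share `|K| ^ (-c ^ 2)` of
matrices of corank `c` among all matrices, once for each member of the pair. -/
theorem abs_rankGenProb_sub_one_sq_le {k K : Type*} [Field k] [Field K] [Finite K] [Algebra k K]
    {n α c e : ℕ} (hn : 2 ≤ n) (hc : α + c = n) (he : 2 * c ^ 2 + e = n - 1) (hne : n ≤ 4 * e) :
    |rankGenProb k K n α - 1| ^ 2 ≤ 2 * 768 ^ 2 / (Nat.card K : ℝ) ^ e := by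
  obtain ⟨b, hb, hbound⟩ := exists_ncard_rankSet_sq_eq_add (k := k) (K := K) hn α
  have hlow := card_matrix_le_mul_ncard_rankSet K α c
  rw [hc] at hlow
  rw [rankGenProb]
  set a := (rankSet K n α).ncard
  set G := (rankGeneratingPairs k K n α).ncard
  set Q := Nat.card K
  have hQ2 : 2 ≤ Q := Finite.one_lt_card
  have hQ : 0 < Q := by omega
  have ha : 0 < a := by
    rcases Nat.eq_zero_or_pos a with h | h
    · rw [h, Nat.mul_zero] at hlow
      have : 0 < Q ^ (n ^ 2) := pow_pos hQ _
      omega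
    · exact h
  have hmain : b * Q ^ e ≤ 768 * e * a ^ 2 := by
    have hpos : 0 < Q ^ (2 * c ^ 2) := pow_pos hQ _
    refine Nat.le_of_mul_le_mul_right ?_ hpos
    calc b * Q ^ e * Q ^ (2 * c ^ 2) = b * Q ^ (n - 1) := by
          rw [← he, pow_add]; ring
      _ ≤ 12 * n * Q ^ (2 * n ^ 2) := hbound
      _ = 12 * n * (Q ^ (n ^ 2)) ^ 2 := by rw [← pow_mul, mul_comm (n ^ 2)]
      _ ≤ 12 * (4 * e) * (4 * Q ^ (c ^ 2) * a) ^ 2 :=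
          Nat.mul_le_mul (Nat.mul_le_mul_left _ hne) (Nat.pow_le_pow_left hlow 2)
      _ = 768 * e * a ^ 2 * Q ^ (2 * c ^ 2) := by
          rw [mul_pow, mul_pow, ← pow_mul, mul_comm (c ^ 2)]; ring
  have haR : (0 : ℝ) < a := by exact_mod_cast ha
  have hQR : (0 : ℝ) < (Q : ℝ) ^ e := by exact_mod_cast pow_pos hQ e
  have hbR : (a : ℝ) ^ 2 = G + b := by exact_mod_cast hb
  have h1 : |(G : ℝ) / (a : ℝ) ^ 2 - 1| = b / (a : ℝ) ^ 2 := by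
    have : (G : ℝ) / (a : ℝ) ^ 2 - 1 = -(b / (a : ℝ) ^ 2) := by
      rw [div_sub_one (by positivity), ← neg_div]
      congr 1
      linarith
    rw [this, abs_neg, abs_of_nonneg (by positivity)]
  rw [h1]
  have h2 : (b : ℝ) / (a : ℝ) ^ 2 ≤ 768 * e / (Q : ℝ) ^ e := by
    rw [div_le_div_iff₀ (by positivity) hQR]
    exact_mod_cast hmain
  have h3 : (e : ℝ) ^ 2 ≤ 2 * (Q : ℝ) ^ e := by
    have h4 := (sq_le_two_mul_two_pow e).trans (Nat.mul_le_mul_left 2 (Nat.pow_le_pow_left hQ2 e))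
    exact_mod_cast h4
  calc ((b : ℝ) / (a : ℝ) ^ 2) ^ 2 ≤ (768 * e / (Q : ℝ) ^ e) ^ 2 :=
        pow_le_pow_left₀ (by positivity) h2 2
    _ = 768 ^ 2 * (e : ℝ) ^ 2 / ((Q : ℝ) ^ e * (Q : ℝ) ^ e) := by
        rw [div_pow, mul_pow, pow_two ((Q : ℝ) ^ e)]
    _ ≤ 768 ^ 2 * (2 * (Q : ℝ) ^ e) / ((Q : ℝ) ^ e * (Q : ℝ) ^ e) := by gcongr
    _ = 2 * 768 ^ 2 / (Q : ℝ) ^ e := by field_simp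

theorem nine_mul_corank_sq_le {n α c : ℕ} (hc : α + c = n)
    (h : (n : ℝ) - Real.sqrt (n : ℝ) / 3 ≤ (α : ℝ)) : 9 * c ^ 2 ≤ n := by
  have h1 : (α : ℝ) + c = n := by exact_mod_cast hc
  have h2 : 3 * (c : ℝ) ≤ Real.sqrt n := by linarith
  have h3 : (3 * (c : ℝ)) ^ 2 ≤ n := by
    have := pow_le_pow_left₀ (by positivity) h2 2
    rwa [Real.sq_sqrt (Nat.cast_nonneg n)] at this
  have h4 : (9 : ℝ) * (c : ℝ) ^ 2 ≤ n := by nlinarith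
  exact_mod_cast h4

end LargeRank

theorem theorem1p8 :
    (∀ (k K : Type*) [Field k] [Finite k] [Field K] [Finite K] [Algebra k K]
        (q m n p α : ℕ), Nat.card k = q → Module.finrank k K = m → 1 < n → 0 < α →
        IsLeast {r : ℕ | r.Prime ∧ r ∣ n} p → (α : ℝ) ≤ (n : ℝ) / (p : ℝ) →
        rankGenProb k K n α ≤ 1 - (q : ℝ) ^ (-(2 * m * p * α ^ 2 : ℤ))) ∧
    (∀ ε : ℝ, 0 < ε → ∃ N : ℕ,
      ∀ (k K : Type*) [Field k] [Finite k] [Field K] [Finite K] [Algebra k K]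
        (n α : ℕ), 1 < n → 0 < α →
        (n : ℝ) - Real.sqrt (n : ℝ) / 3 ≤ (α : ℝ) → α ≤ n →
        N ≤ Nat.card (Matrix (Fin n) (Fin n) K) →
        |rankGenProb k K n α - 1| < ε) := by
  refine ⟨?_, ?_⟩
  · intro k K _ _ _ _ _ q m n p α hq hm hn hα hp hle
    have hp0 : (0 : ℝ) < p := by exact_mod_cast hp.1.1.pos
    have hle' : α * p ≤ n := by
      rw [le_div_iff₀ hp0] at hle
      exact_mod_cast hle
    have h := rankGenProb_le (k := k) (K := K) hn hp.1.1 hle'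
    have hcard : Nat.card K = q ^ m := by
      rw [← hq, ← hm, Module.natCard_eq_pow_finrank (K := k)]
    have hexp : (q : ℝ) ^ (-(2 * m * p * α ^ 2 : ℤ)) =
        ((Nat.card K : ℝ) ^ (2 * p * α ^ 2))⁻¹ := by
      rw [zpow_neg, hcard, Nat.cast_pow, ← pow_mul, ← zpow_natCast]
      congr 2
      push_cast
      ring
    rw [hexp]
    exact h
  · intro ε hε
    obtain ⟨M, hM⟩ := exists_nat_gt (2 * 768 ^ 2 / ε ^ 2)
    refine ⟨M ^ (16 * M) + 1, ?_⟩
    intro k K _ _ _ _ _ n α hn hα hroot hαn hN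
    obtain ⟨c, hc⟩ := Nat.exists_eq_add_of_le hαn
    have h9 := nine_mul_corank_sq_le hc.symm hroot
    obtain ⟨e, he⟩ : ∃ e, 2 * c ^ 2 + e = n - 1 := ⟨n - 1 - 2 * c ^ 2, by omega⟩
    have hne : n ≤ 4 * e := by omega
    have hQ2 : 2 ≤ Nat.card K := Finite.one_lt_card
    -- if `|K| ^ e` is bounded, then so are `e`, `n ≤ 4 * e` and `|A| = |K| ^ (n ^ 2)`
    have hlarge : M < Nat.card K ^ e := by
      by_contra! hsmall
      have heM : e ≤ M := (Nat.lt_pow_self hQ2).le.trans hsmall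
      have hM0 : 0 < M := lt_of_lt_of_le (pow_pos (by omega) _) hsmall
      have : Nat.card (Matrix (Fin n) (Fin n) K) ≤ M ^ (16 * M) := by
        rw [natCard_matrix_fin]
        calc Nat.card K ^ (n * n) ≤ Nat.card K ^ (e * (16 * e)) :=
              Nat.pow_le_pow_right (by omega) (by nlinarith)
          _ = (Nat.card K ^ e) ^ (16 * e) := pow_mul _ _ _
          _ ≤ M ^ (16 * e) := Nat.pow_le_pow_left hsmall _
          _ ≤ M ^ (16 * M) := Nat.pow_le_pow_right hM0 (by omega)
      omega
    have hsq := abs_rankGenProb_sub_one_sq_le (k := k) (K := K) hn hc.symm he hne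
    refine lt_of_pow_lt_pow_left₀ 2 hε.le (hsq.trans_lt ?_)
    have hMe : (M : ℝ) < (Nat.card K : ℝ) ^ e := by exact_mod_cast hlarge
    have hpos : (0 : ℝ) < (Nat.card K : ℝ) ^ e := by positivity
    rw [div_lt_iff₀ hpos, ← div_lt_iff₀' (by positivity)]
    exact hM.trans hMe
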